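/- For a real or complex random variable $\gamma$ on a probability space $(\Omega,\mathcal A,\mathbb P)$ with values in $\mathbb K\in\{\mathbb R,\mathbb C\}$, call $\gamma$ subgaussian if there is $s\ge 0$ with $\mathbb E\exp(\mathrm{Re}(z\gamma))\le \exp(s^2|z|^2/2)$ for all $z\in\mathbb K$, and let $\mathrm{sg}(\gamma)$ be the best such $s$. For $1\le r<\infty$ let $\varphi_r(t)=e^{t^r}-1$ and $\|f\|_{L_{\varphi_r}}=\inf\{\varepsilon>0:\int_\Omega\varphi_r(|f|/\varepsilon)\,d\mathbb P\le 1\}$. For $\alpha\in\mathbb N_0^n$ write $|\alpha|=\sum_i\alpha_i$, $\alpha!=\prod_i\alpha_i!$ and $z^\alpha=\prod_i z_i^{\alpha_i}$. Let $r\in[2,\infty)$, let $r'=r/(r-1)$, let $s\ge 0$, and, if $r>2$, let $M\ge 0$. There is a constant $C_r>0$, depending only on $s$ if $r=2$ and only on $r,s,M$ if $r>2$, such that the following holds. Let $n\ge 1$ and $m\ge 0$ be integers, let $\|\cdot\|$ be a norm on $\mathbb C^n$, let $B_X$ be the closed unit ball of $X=(\mathbb C^n,\|\cdot\|)$, let $(c_\alpha)_{|\alpha|\le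 m}$ be complex numbers, and let $(\gamma_\alpha)_{|\alpha|\le m}$ be a family of independent subgaussian random variables (all real or all complex) on a probability space $(\Omega,\mathcal A,\mathbb P)$ with $\mathrm{sg}(\gamma_\alpha)\le s$ for all $\alpha$ and, if $r>2$, also $\|\gamma_\alpha\|_\infty\le M$ for all $\alpha$. Then $$\bigg\|\sup_{z\in B_X}\Big|\sum_{|\alpha|\le m}\gamma_\alpha c_\alpha z^\alpha\Big|\bigg\|_{L_{\varphi_r}}\le C_r\,\big(n(1+\log m)\big)^{1/r}\bigg(\sum_{k=0}^m\Big(\sup_{|\alpha|=k}\frac{|c_\alpha|^{r'}\alpha!}{k!}\Big)\sup_{z\in B_X}\Big(\sum_{i=1}^n|z_i|^{r'}\Big)^k\bigg)^{1/r'},$$ where $\log m$ is read as $0$ if $m=0$. -/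

import Mathlib

open MeasureTheory ProbabilityTheory
open scoped ENNReal BigOperators

/-- The exponential Orlicz function `φ_r(t) = exp (t ^ r) - 1`, used for `t ≥ 0`. -/
noncomputable def expOrlicz (r t : ℝ) : ℝ := Real.exp (t ^ r) - 1

/-- The Orlicz (Luxemburg) norm of `f` in `L_{φ_r}(P)`, with values in `[0, ∞]`: the infimum of
all `ε > 0` with `∫ φ_r (|f| / ε) dP ≤ 1`, and `∞` if there is no such `ε`. -/
noncomputable def expOrliczNorm {Ω : Type*} [MeasurableSpace Ω] (r : ℝ) (f : Ω → ℝ)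
    (P : Measure Ω) : ℝ≥0∞ :=
  ⨅ ε ∈ {ε : ℝ | 0 < ε ∧ ∫⁻ ω, ENNReal.ofReal (expOrlicz r (|f ω| / ε)) ∂P ≤ 1},
    ENNReal.ofReal ε

/-- The numbers `s ≥ 0` such that `E exp (Re (z f)) ≤ exp (s² |z|² / 2)` for all scalars `z`.
For `𝕜 = ℝ` the condition reads `E exp (x f) ≤ exp (s² x² / 2)` for all real `x`. -/
def subgaussianConstants {Ω 𝕜 : Type*} [MeasurableSpace Ω] [RCLike 𝕜] (f : Ω → 𝕜)
    (P : Measure Ω) : Set ℝ :=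
  {s : ℝ | 0 ≤ s ∧ ∀ z : 𝕜,
    ∫⁻ ω, ENNReal.ofReal (Real.exp (RCLike.re (z * f ω))) ∂P
      ≤ ENNReal.ofReal (Real.exp (s ^ 2 * ‖z‖ ^ 2 / 2))}

/-- A (real or complex) random variable `f` is subgaussian. -/
def IsSubgaussian {Ω 𝕜 : Type*} [MeasurableSpace Ω] [RCLike 𝕜] (f : Ω → 𝕜)
    (P : Measure Ω) : Prop :=
  Measurable f ∧ (subgaussianConstants f P).Nonempty

/-- The best subgaussian constant `sg(f)`. -/
noncomputable def sg {Ω 𝕜 : Type*} [MeasurableSpace Ω] [RCLike 𝕜] (f : Ω → 𝕜)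
    (P : Measure Ω) : ℝ :=
  sInf (subgaussianConstants f P)

/-- The multi-indices `α ∈ ℕ₀ⁿ` of order `|α| = k`. -/
def multiIndicesEq (n k : ℕ) : Finset (Fin n → ℕ) := Finset.piAntidiag Finset.univ k

/-- The multi-indices `α ∈ ℕ₀ⁿ` of order `|α| ≤ m`. -/
def multiIndicesLE (n m : ℕ) : Finset (Fin n → ℕ) :=
  (Finset.range (m + 1)).biUnion (multiIndicesEq n)

/-- The value at `z` of the polynomial `∑_{|α| ≤ m} g_α c_α z^α` with `g_α ∈ 𝕜`, where `𝕜` is `ℝ`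
or `ℂ` and `RCLike.map 𝕜 ℂ` is the canonical embedding of `𝕜` into `ℂ`. -/
noncomputable def polyValue {𝕜 : Type*} [RCLike 𝕜] {n m : ℕ} (g : multiIndicesLE n m → 𝕜)
    (c : (Fin n → ℕ) → ℂ) (z : Fin n → ℂ) : ℂ :=
  ∑ α : multiIndicesLE n m, RCLike.map 𝕜 ℂ (g α) * c α * ∏ i, z i ^ (α : Fin n → ℕ) i

/-- The supremum of `|∑_{|α| ≤ m} g_α c_α z^α|` over the closed unit ball of `N`. If `N` is a norm
on `ℂⁿ`, this ball is compact, so the supremum is finite. -/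
noncomputable def polySup {𝕜 : Type*} [RCLike 𝕜] {n m : ℕ} (N : Seminorm ℂ (Fin n → ℂ))
    (g : multiIndicesLE n m → 𝕜) (c : (Fin n → ℕ) → ℂ) : ℝ :=
  ⨆ z : N.closedBall 0 1, ‖polyValue g c z‖

/-- The number
`∑_{k=0}^m (sup_{|α| = k} |c_α|^q α! / k!) · sup_{N z ≤ 1} (∑_i |z_i|^q)^k`. -/
noncomputable def coeffSum {n : ℕ} (m : ℕ) (q : ℝ) (N : Seminorm ℂ (Fin n → ℂ))
    (c : (Fin n → ℕ) → ℂ) : ℝ :=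
  ∑ k ∈ Finset.range (m + 1),
    (⨆ α : multiIndicesEq n k,
      ‖c α‖ ^ q * (∏ i, ((α : Fin n → ℕ) i).factorial : ℕ) / (k.factorial : ℝ)) *
    ⨆ z : N.closedBall 0 1, (∑ i, ‖(z : Fin n → ℂ) i‖ ^ q) ^ k

/-! For fixed `z` the random polynomial is a linear combination of independent variables with
coefficients `c_α z^α`. If `A` bounds the `ℓ_{r'}` norm of the coefficients, its tail is at most `4
exp (-κ (t / A) ^ r)`. For `r = 2` this is Chernoff's bound. For `r > 2` the coefficients are split
by size: the few large ones contribute at most `t / 2` because the variables are bounded, and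
Chernoff's bound handles the small ones. By the multinomial theorem, `A = coeffSum ^ (1 / r')` works
for every `z` in the ball.

The supremum over the ball is at most twice a maximum over a finite set. Bernstein's inequality
makes a polynomial of degree at most `m` Lipschitz near the ball, with constant of order `m` times
its supremum, for any complex norm; a net of mesh of order `1 / m` therefore suffices, and volume
comparison gives one with at most `(25 m) ^ (2 n)` points. The union bound costs this cardinality,
whose logarithm is of order `n (1 + log m)`; enlarging the Orlicz scale by `(n (1 + log m)) ^ (1 /
r)` absorbs it. -/

/-! ### Nets in the unit ball by volume comparison -/

/-- A `δ`-separated subset of the unit ball has at most `(1 + 2 / δ) ^ dim` elements. -/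
theorem card_le_of_separated_unitBall {E : Type*} [NormedAddCommGroup E] [NormedSpace ℝ E]
    [FiniteDimensional ℝ E] {δ : ℝ} (hδ : 0 < δ) (s : Finset E) (hs : ∀ c ∈ s, ‖c‖ ≤ 1)
    (h : ∀ c ∈ s, ∀ d ∈ s, c ≠ d → δ ≤ ‖c - d‖) :
    (s.card : ℝ) ≤ (1 + 2 / δ) ^ Module.finrank ℝ E := by
  borelize E
  let μ : Measure E := Measure.addHaar
  have hδ2 : 0 < δ / 2 := by positivity
  have hρ : 0 < 1 + δ / 2 := by positivity
  have D : Set.Pairwise (s : Set E) (Function.onFun Disjoint fun c => Metric.ball (c : E) (δ / 2)) := by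
    rintro c hc d hd hcd
    apply Metric.ball_disjoint_ball
    rw [dist_eq_norm]
    linarith [h c hc d hd hcd]
  have hsub : (⋃ c ∈ s, Metric.ball (c : E) (δ / 2)) ⊆ Metric.ball 0 (1 + δ / 2) := by
    refine Set.iUnion₂_subset fun x hx => Metric.ball_subset_ball' ?_
    rw [dist_zero_right]
    linarith [hs x hx]
  have I : (s.card : ℝ≥0∞) * ENNReal.ofReal ((δ / 2) ^ Module.finrank ℝ E) * μ (Metric.ball 0 1) ≤
      ENNReal.ofReal ((1 + δ / 2) ^ Module.finrank ℝ E) * μ (Metric.ball 0 1) := by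
    have := measure_mono (μ := μ) hsub
    rw [measure_biUnion_finset D fun c _ => measurableSet_ball] at this
    simp only [μ.addHaar_ball_of_pos _ hδ2, μ.addHaar_ball_of_pos _ hρ, Finset.sum_const,
      nsmul_eq_mul] at this
    rwa [mul_assoc]
  have J := (ENNReal.mul_le_mul_iff_left (Metric.measure_ball_pos μ _ zero_lt_one).ne'
    measure_ball_lt_top.ne).1 I
  have K := ENNReal.toReal_le_of_le_ofReal (pow_nonneg hρ.le _) J
  rw [ENNReal.toReal_mul, ENNReal.toReal_natCast, ENNReal.toReal_ofReal (by positivity)] at K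
  have e : (1 + 2 / δ) = (1 + δ / 2) / (δ / 2) := by
    field_simp
    ring
  rw [e, div_pow, le_div_iff₀ (by positivity)]
  exact K

/-- A separated set that is not a net can be enlarged by one point. If no net were this small,
separated sets would grow forever, against the volume bound. -/
theorem exists_net_unitBall (E : Type*) [NormedAddCommGroup E] [NormedSpace ℝ E]
    [FiniteDimensional ℝ E] {δ : ℝ} (hδ : 0 < δ) :
    ∃ s : Finset E, s.Nonempty ∧ (∀ c ∈ s, ‖c‖ ≤ 1) ∧ (∀ x : E, ‖x‖ ≤ 1 → ∃ c ∈ s, ‖x - c‖ < δ) ∧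
      (s.card : ℝ) ≤ (1 + 2 / δ) ^ Module.finrank ℝ E := by
  classical
  by_contra! H
  have key : ∀ k : ℕ, ∃ s : Finset E, s.card = k + 1 ∧ (∀ c ∈ s, ‖c‖ ≤ 1) ∧
      (∀ c ∈ s, ∀ d ∈ s, c ≠ d → δ ≤ ‖c - d‖) := by
    intro k
    induction k with
    | zero => exact ⟨{0}, by simp, by simp, by simp⟩
    | succ k ih =>
      obtain ⟨s, hk, h1, h2⟩ := ih
      have hne : s.Nonempty := Finset.card_pos.1 (by omega)
      have : ∃ x : E, ‖x‖ ≤ 1 ∧ ∀ c ∈ s, δ ≤ ‖x - c‖ := by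
        by_contra! h3
        exact absurd (card_le_of_separated_unitBall hδ s h1 h2) (not_le.2 (H s hne h1 h3))
      obtain ⟨x, hx, hxs⟩ := this
      have hxn : x ∉ s := fun hmem => by
        have := hxs x hmem
        simp at this
        linarith
      refine ⟨insert x s, by rw [Finset.card_insert_of_notMem hxn, hk], ?_, ?_⟩
      · simpa using ⟨hx, h1⟩
      · intro c hc d hd hcd
        rcases Finset.mem_insert.1 hc with hc | hc <;> rcases Finset.mem_insert.1 hd with hd | hd
        · exact absurd (hc.trans hd.symm) hcd
        · exact hc ▸ hxs d hd
        · rw [norm_sub_rev, hd]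
          exact hxs c hc
        · exact h2 c hc d hd hcd
  obtain ⟨k, hk⟩ := exists_nat_gt ((1 + 2 / δ) ^ Module.finrank ℝ E)
  obtain ⟨s, hs, h1, h2⟩ := key k
  have := card_le_of_separated_unitBall hδ s h1 h2
  rw [hs] at this
  push_cast at this
  linarith

/-! ### Bernstein inequalities and norming sets -/

/-- Bernstein's growth lemma on the disc. -/
theorem Polynomial.norm_eval_le_of_bounded_on_disc {p : Polynomial ℂ} {m : ℕ} {M : ℝ}
    (hp : p.natDegree ≤ m) (hM : ∀ t : ℂ, ‖t‖ ≤ 1 → ‖p.eval t‖ ≤ M) {t : ℂ} (ht : 1 ≤ ‖t‖) :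
    ‖p.eval t‖ ≤ M * ‖t‖ ^ m := by
  have key : ∀ s : ℂ, s ≠ 0 → (p.reflect m).eval s⁻¹ * s ^ m = p.eval s := by
    intro s hs
    have : Invertible s := invertibleOfNonzero hs
    have := Polynomial.eval₂_reflect_mul_pow (RingHom.id ℂ) s m p hp
    simpa [Polynomial.eval₂_id] using this
  have ht0 : t ≠ 0 := norm_pos_iff.1 (by linarith)
  rw [← key t ht0, norm_mul, norm_pow]
  refine mul_le_mul_of_nonneg_right ?_ (by positivity)
  -- Maximum principle for the reversed polynomial `s ^ m p(1 / s)`, which has the same modulus as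
  -- `p(1 / s)` on the unit circle.
  refine Complex.norm_le_of_forall_mem_frontier_norm_le (U := Metric.ball 0 1)
    (f := fun s => (p.reflect m).eval s) Metric.isBounded_ball
    (Polynomial.differentiable _).diffContOnCl ?_ ?_
  · intro z hz
    rw [frontier_ball _ one_ne_zero, mem_sphere_zero_iff_norm] at hz
    have hz0 : z⁻¹ ≠ 0 := inv_ne_zero (norm_pos_iff.1 (by linarith))
    have h1 := key z⁻¹ hz0
    rw [inv_inv] at h1
    have h2 := hM z⁻¹ (by rw [norm_inv, hz, inv_one])
    rw [← h1, norm_mul, norm_pow, norm_inv, hz] at h2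
    simpa using h2
  · rw [closure_ball _ one_ne_zero, mem_closedBall_zero_iff, norm_inv]
    exact inv_le_one_of_one_le₀ ht

/-- A function whose restrictions to complex lines are polynomials of degree at most `m`. -/
def IsLinewisePolynomial {E : Type*} [AddCommGroup E] [Module ℂ E] (m : ℕ) (f : E → ℂ) : Prop :=
  ∀ x y : E, ∃ p : Polynomial ℂ, p.natDegree ≤ m ∧ ∀ t : ℂ, f (x + t • y) = p.eval t

section LinewisePolynomial

variable {E : Type*} [NormedAddCommGroup E] [NormedSpace ℂ E] {m : ℕ} {f : E → ℂ}

theorem IsLinewisePolynomial.norm_le_growth {M : ℝ}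
    (hf : IsLinewisePolynomial m f) (hM : ∀ x, ‖x‖ ≤ 1 → ‖f x‖ ≤ M) {R : ℝ} (hR : 1 ≤ R)
    {x : E} (hx : ‖x‖ ≤ R) : ‖f x‖ ≤ M * R ^ m := by
  have hM0 : 0 ≤ M := (norm_nonneg _).trans (hM 0 (by simp))
  obtain ⟨p, hp, h⟩ := hf 0 ((R⁻¹ : ℂ) • x)
  have hR0 : (R : ℂ) ≠ 0 := by
    norm_cast
    linarith
  have h1 : f x = p.eval (R : ℂ) := by
    rw [← h]
    simp [smul_smul, hR0]
  have hn : ‖(R : ℂ)‖ = R := by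
    rw [Complex.norm_real, Real.norm_of_nonneg (by linarith)]
  rw [h1]
  have := Polynomial.norm_eval_le_of_bounded_on_disc hp (M := M) (t := (R : ℂ)) ?_ (by rwa [hn])
  · rwa [hn] at this
  · intro t ht
    rw [← h]
    apply hM
    rw [zero_add, norm_smul, norm_smul, norm_inv, hn]
    have : R⁻¹ * ‖x‖ ≤ 1 := by
      rw [inv_mul_le_iff₀ (by linarith)]
      linarith
    exact mul_le_one₀ ht (by positivity) this

/-- A Bernstein-type Lipschitz estimate for polynomials on the unit ball of a complex norm. -/
theorem IsLinewisePolynomial.dist_le {M : ℝ} (hm : 1 ≤ m)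
    (hf : IsLinewisePolynomial m f) (hM : ∀ x, ‖x‖ ≤ 1 → ‖f x‖ ≤ M) {x w : E}
    (hw : ‖w‖ ≤ 1) (hxw : ‖x - w‖ < 1 / m) :
    ‖f x - f w‖ ≤ 2 * Real.exp 1 * M * m * ‖x - w‖ := by
  have hm0 : (0 : ℝ) < m := by exact_mod_cast hm
  have hM0 : 0 ≤ M := (norm_nonneg _).trans (hM 0 (by simp))
  rcases eq_or_ne x w with rfl | hne
  · simp
  have hd : 0 < ‖x - w‖ := norm_pos_iff.2 (sub_ne_zero.2 hne)
  set d := ‖x - w‖ with hd_def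
  -- Leaving the unit ball by `1 / m` costs only the factor `(1 + 1 / m) ^ m ≤ e`.
  have hgrow : ∀ y : E, ‖y‖ ≤ 1 + 1 / m → ‖f y‖ ≤ Real.exp 1 * M := by
    intro y hy
    have h1 := hf.norm_le_growth hM (by simp) hy
    have h2 : (1 + 1 / (m : ℝ)) ^ m ≤ Real.exp 1 := by
      have : (1 + 1 / (m : ℝ)) ≤ Real.exp (1 / m) := by
        linarith [Real.add_one_le_exp (1 / (m : ℝ))]
      calc (1 + 1 / (m : ℝ)) ^ m ≤ Real.exp (1 / m) ^ m := by gcongr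
        _ = Real.exp 1 := by
          rw [← Real.exp_nat_mul]
          congr 1
          field_simp
    nlinarith
  obtain ⟨p, hp, h⟩ := hf w ((d⁻¹ : ℂ) • (x - w))
  have hd0 : (d : ℂ) ≠ 0 := by exact_mod_cast hd.ne'
  have hx : f x = p.eval (d : ℂ) := by
    rw [← h]
    simp [smul_smul, hd0]
  have hw0 : f w = p.eval 0 := by
    rw [← h]
    simp
  have hn : ‖(d : ℂ)‖ = d := by
    rw [Complex.norm_real, Real.norm_of_nonneg hd.le]
  have hball : ∀ t : ℂ, ‖t‖ ≤ 1 / m → ‖p.eval t‖ ≤ Real.exp 1 * M := by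
    intro t ht
    rw [← h]
    apply hgrow
    refine (norm_add_le _ _).trans (add_le_add hw ?_)
    rw [norm_smul, norm_smul, norm_inv, hn, ← hd_def, inv_mul_cancel₀ hd.ne', mul_one]
    exact ht
  -- Schwarz lemma on the complex line through `w` and `x`: the disc of radius `1 / m` goes into a
  -- disc of radius `2 e M` about `f w`.
  have := Complex.dist_le_div_mul_dist_of_mapsTo_ball (f := fun t => p.eval t) (c := 0)
    (R₁ := 1 / m) (R₂ := 2 * (Real.exp 1 * M)) (z := (d : ℂ)) p.differentiable.differentiableOn
    ?_ (by rwa [mem_ball_zero_iff, hn])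
  · rw [dist_eq_norm, dist_zero_right, hn, ← hx, ← hw0] at this
    refine this.trans (le_of_eq ?_)
    field_simp
  · intro t ht
    rw [Metric.mem_closedBall, dist_eq_norm]
    rw [mem_ball_zero_iff] at ht
    refine (norm_sub_le _ _).trans ?_
    have := hball t ht.le
    have := hball 0 (by simp)
    linarith

/-- A finite set of the unit ball that norms all polynomials of degree at most `m`. -/
theorem exists_norming_finset (E : Type*) [NormedAddCommGroup E] [NormedSpace ℂ E]
    [FiniteDimensional ℂ E] {m : ℕ} (hm : 1 ≤ m) :
    ∃ s : Finset E, s.Nonempty ∧ (∀ c ∈ s, ‖c‖ ≤ 1) ∧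
      (s.card : ℝ) ≤ (25 * m : ℝ) ^ (2 * Module.finrank ℂ E) ∧
      ∀ f : E → ℂ, IsLinewisePolynomial m f → BddAbove ((fun x => ‖f x‖) '' Metric.closedBall 0 1) →
        ∀ b : ℝ, (∀ c ∈ s, ‖f c‖ ≤ b) → ∀ x : E, ‖x‖ ≤ 1 → ‖f x‖ ≤ 2 * b := by
  have hm1 : (1 : ℝ) ≤ m := by exact_mod_cast hm
  have hm0 : (0 : ℝ) < m := by exact_mod_cast hm
  have he : Real.exp 1 < 3 := Real.exp_one_lt_three
  -- Since `2 e < 6`, this mesh makes the Lipschitz error at most `M / 2`, and `1 + 2 / δ = 1 + 24 m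
  -- ≤ 25 m`.
  have hδ : (0 : ℝ) < 1 / (12 * m) := by positivity
  obtain ⟨s, hne, h1, h2, h3⟩ := exists_net_unitBall E hδ
  refine ⟨s, hne, h1, ?_, ?_⟩
  · refine h3.trans ?_
    rw [finrank_real_of_complex]
    refine pow_le_pow_left₀ (by positivity) ?_ _
    rw [div_div_eq_mul_div]
    linarith
  · intro f hf hbdd b hb x hx
    set M := sSup ((fun x => ‖f x‖) '' Metric.closedBall 0 1) with hMdef
    have hM : ∀ x, ‖x‖ ≤ 1 → ‖f x‖ ≤ M := fun x hx =>
      le_csSup hbdd ⟨x, by simpa using hx, rfl⟩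
    have hM0 : 0 ≤ M := (norm_nonneg _).trans (hM 0 (by simp))
    have hMb : M ≤ b + M / 2 := by
      refine csSup_le ⟨_, 0, by simp, rfl⟩ ?_
      rintro _ ⟨y, hy, rfl⟩
      obtain ⟨c, hc, hyc⟩ := h2 y (by simpa using hy)
      have h4 := hf.dist_le hm hM (h1 c hc) (x := y) (hyc.trans_le (by gcongr; linarith))
      have h5 : 2 * Real.exp 1 * M * m * ‖y - c‖ ≤ M / 2 := by
        calc 2 * Real.exp 1 * M * m * ‖y - c‖ ≤ 2 * 3 * M * m * (1 / (12 * m)) := by gcongr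
          _ = M / 2 := by
            field_simp
            ring
      have h6 := norm_le_norm_add_norm_sub' (f y) (f c)
      have := hb c hc
      simp only
      linarith
    linarith [hM x hx]

end LinewisePolynomial

/-! ### Tail estimates for linear combinations -/

section Tails

variable {Ω 𝕜 ι : Type*} [RCLike 𝕜] [MeasurableSpace Ω] [Fintype ι] {P : Measure Ω}

/-- `RCLike.map ℂ 𝕜` is the real part if `𝕜 = ℝ` and the identity if `𝕜 = ℂ`. It turns a complex
coefficient into a scalar admissible in `subgaussianConstants`, so both cases are treated at once.
-/
theorem RCLike.re_map_mul (x : 𝕜) (b : ℂ) :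
    (RCLike.map 𝕜 ℂ x * b).re = RCLike.re (RCLike.map ℂ 𝕜 b * x) := by
  have h := RCLike.mul_im_I_ax x
  simp [RCLike.map_apply, RCLike.mul_re]
  linear_combination b.im * h

theorem RCLike.norm_map_complex_le (b : ℂ) : ‖RCLike.map ℂ 𝕜 b‖ ≤ ‖b‖ := by
  rw [← sq_le_sq₀ (norm_nonneg _) (norm_nonneg _), ← RCLike.normSq_eq_def', ← RCLike.normSq_eq_def']
  rcases RCLike.I_eq_zero_or_im_I_eq_one (K := 𝕜) with h | h
  · simp [RCLike.map_apply, RCLike.normSq_apply, h]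
    nlinarith [sq_nonneg b.im]
  · simp [RCLike.map_apply, RCLike.normSq_apply, h]

theorem lintegral_exp_re_map_mul_le {f : Ω → 𝕜} {S : ℝ} (hS : S ∈ subgaussianConstants f P)
    (b : ℂ) : ∫⁻ ω, ENNReal.ofReal (Real.exp (RCLike.map 𝕜 ℂ (f ω) * b).re) ∂P
      ≤ ENNReal.ofReal (Real.exp (S ^ 2 * ‖b‖ ^ 2 / 2)) := by
  simp_rw [RCLike.re_map_mul]
  refine (hS.2 _).trans (ENNReal.ofReal_le_ofReal (Real.exp_le_exp.2 ?_))
  have := RCLike.norm_map_complex_le (𝕜 := 𝕜) b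
  gcongr

theorem mem_subgaussianConstants_of_sg_lt {f : Ω → 𝕜} (hf : IsSubgaussian f P) {S : ℝ}
    (h : sg f P < S) : S ∈ subgaussianConstants f P := by
  obtain ⟨s, hs, hsS⟩ := exists_lt_of_csInf_lt hf.2 h
  refine ⟨hs.1.trans hsS.le, fun z => (hs.2 z).trans ?_⟩
  have := hs.1
  gcongr

variable {γ : ι → Ω → 𝕜} {S : ℝ}

theorem lintegral_exp_re_sum_le (hind : iIndepFun γ P) (hmeas : ∀ i, Measurable (γ i))
    (hS : ∀ i, S ∈ subgaussianConstants (γ i) P) (a : ι → ℂ) :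
    ∫⁻ ω, ENNReal.ofReal (Real.exp (∑ i, RCLike.map 𝕜 ℂ (γ i ω) * a i).re) ∂P
      ≤ ENNReal.ofReal (Real.exp (S ^ 2 * (∑ i, ‖a i‖ ^ 2) / 2)) := by
  have hg : ∀ i, Measurable fun x : 𝕜 => ENNReal.ofReal (Real.exp (RCLike.map 𝕜 ℂ x * a i).re) := by
    intro i
    apply Measurable.ennreal_ofReal
    apply Continuous.measurable
    fun_prop
  have h := lintegral_prod_eq_prod_lintegral_of_indepFun Finset.univ _ (hind.comp _ hg)
    (fun i => (hg i).comp (hmeas i))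
  simp only [Function.comp_apply] at h
  simp_rw [Complex.re_sum, Real.exp_sum]
  simp_rw [ENNReal.ofReal_prod_of_nonneg (fun i _ => (Real.exp_pos _).le)]
  rw [h, Finset.mul_sum, Finset.sum_div, Real.exp_sum,
    ENNReal.ofReal_prod_of_nonneg (fun i _ => (Real.exp_pos _).le)]
  exact Finset.prod_le_prod' fun i _ => lintegral_exp_re_map_mul_le (hS i) (a i)

theorem measurable_sum_map_mul (hmeas : ∀ i, Measurable (γ i)) (a : ι → ℂ) :
    Measurable fun ω => ∑ i, RCLike.map 𝕜 ℂ (γ i ω) * a i := by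
  refine Finset.measurable_fun_sum _ fun i _ => ?_
  exact ((RCLike.map 𝕜 ℂ).continuous.measurable.comp (hmeas i)).mul_const _

theorem measure_le_re_sum_le (hind : iIndepFun γ P) (hmeas : ∀ i, Measurable (γ i))
    (hS : ∀ i, S ∈ subgaussianConstants (γ i) P) (a : ι → ℂ) {V : ℝ} (hV : 0 < V)
    (haV : S ^ 2 * ∑ i, ‖a i‖ ^ 2 ≤ V) {u : ℂ} (hu : ‖u‖ = 1) {t : ℝ} (ht : 0 < t) :
    P {ω | t ≤ (u * ∑ i, RCLike.map 𝕜 ℂ (γ i ω) * a i).re}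
      ≤ ENNReal.ofReal (Real.exp (-(t ^ 2) / (2 * V))) := by
  -- The minimizer of the Chernoff exponent `l ^ 2 V / 2 - l t`.
  set l : ℝ := t / V with hl
  have hl0 : 0 < l := by positivity
  have h1 := lintegral_exp_re_sum_le hind hmeas hS (fun i => (l : ℂ) * u * a i)
  have h2 : ∀ ω, (∑ i, RCLike.map 𝕜 ℂ (γ i ω) * ((l : ℂ) * u * a i)).re
      = l * (u * ∑ i, RCLike.map 𝕜 ℂ (γ i ω) * a i).re := by
    intro ω
    rw [← Complex.re_ofReal_mul, Finset.mul_sum, Finset.mul_sum]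
    congr 1
    exact Finset.sum_congr rfl fun i _ => by ring
  simp_rw [h2] at h1
  have h3 : Measurable fun ω => ENNReal.ofReal
      (Real.exp (l * (u * ∑ i, RCLike.map 𝕜 ℂ (γ i ω) * a i).re)) := by
    have := measurable_sum_map_mul hmeas a
    fun_prop
  have h4 := meas_ge_le_lintegral_div h3.aemeasurable (μ := P) (ε := ENNReal.ofReal (Real.exp (l * t)))
    (by simp [Real.exp_pos]) ENNReal.ofReal_ne_top
  calc P {ω | t ≤ (u * ∑ i, RCLike.map 𝕜 ℂ (γ i ω) * a i).re}
      ≤ _ := measure_mono fun ω hω => by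
        simp only [Set.mem_ofPred_eq] at hω ⊢
        gcongr
    _ ≤ _ := h4
    _ ≤ ENNReal.ofReal (Real.exp (S ^ 2 * (∑ i, ‖(l : ℂ) * u * a i‖ ^ 2) / 2)) /
          ENNReal.ofReal (Real.exp (l * t)) := by gcongr
    _ = ENNReal.ofReal (Real.exp (S ^ 2 * (∑ i, ‖(l : ℂ) * u * a i‖ ^ 2) / 2 - l * t)) := by
        rw [← ENNReal.ofReal_div_of_pos (Real.exp_pos _), Real.exp_sub]
    _ ≤ _ := by
        refine ENNReal.ofReal_le_ofReal (Real.exp_le_exp.2 ?_)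
        have : ∑ i, ‖(l : ℂ) * u * a i‖ ^ 2 = l ^ 2 * ∑ i, ‖a i‖ ^ 2 := by
          simp [hu, mul_pow, Finset.mul_sum]
        rw [this]
        have : S ^ 2 * (l ^ 2 * ∑ i, ‖a i‖ ^ 2) ≤ l ^ 2 * V := by nlinarith [sq_nonneg l]
        have e : -(t ^ 2) / (2 * V) = l ^ 2 * V / 2 - l * t := by
          rw [hl]
          field_simp
          ring
        linarith

/-- Subgaussian tail estimate for complex linear combinations. -/
theorem measure_le_norm_sum_le (hind : iIndepFun γ P) (hmeas : ∀ i, Measurable (γ i))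
    (hS : ∀ i, S ∈ subgaussianConstants (γ i) P) (a : ι → ℂ) {V : ℝ} (hV : 0 < V)
    (haV : S ^ 2 * ∑ i, ‖a i‖ ^ 2 ≤ V) {t : ℝ} (ht : 0 < t) :
    P {ω | t ≤ ‖∑ i, RCLike.map 𝕜 ℂ (γ i ω) * a i‖}
      ≤ 4 * ENNReal.ofReal (Real.exp (-(t ^ 2) / (8 * V))) := by
  have h : ∀ u : ℂ, ‖u‖ = 1 → P {ω | t / 2 ≤ (u * ∑ i, RCLike.map 𝕜 ℂ (γ i ω) * a i).re}
      ≤ ENNReal.ofReal (Real.exp (-(t ^ 2) / (8 * V))) := by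
    intro u hu
    refine (measure_le_re_sum_le hind hmeas hS a hV haV hu (half_pos ht)).trans_eq ?_
    congr 2
    field_simp
    ring
  -- A complex number of modulus at least `t` has one of `±Re`, `±Im` at least `t / 2`; hence the
  -- factor `4` and the `8 V`.
  have hsub : {ω | t ≤ ‖∑ i, RCLike.map 𝕜 ℂ (γ i ω) * a i‖} ⊆
      (({ω | t / 2 ≤ ((1 : ℂ) * ∑ i, RCLike.map 𝕜 ℂ (γ i ω) * a i).re} ∪
      {ω | t / 2 ≤ ((-1 : ℂ) * ∑ i, RCLike.map 𝕜 ℂ (γ i ω) * a i).re}) ∪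
      {ω | t / 2 ≤ (Complex.I * ∑ i, RCLike.map 𝕜 ℂ (γ i ω) * a i).re}) ∪
      {ω | t / 2 ≤ (-Complex.I * ∑ i, RCLike.map 𝕜 ℂ (γ i ω) * a i).re} := by
    intro ω hω
    simp only [Set.mem_ofPred_eq, Set.mem_union] at hω ⊢
    generalize ∑ i, RCLike.map 𝕜 ℂ (γ i ω) * a i = F at hω ⊢
    have h1 := hω.trans (Complex.norm_le_abs_re_add_abs_im F)
    simp only [one_mul, neg_mul, Complex.neg_re, Complex.I_mul_re, neg_neg]
    by_contra! h2
    have h3 : |F.re| < t / 2 := abs_lt.2 ⟨by linarith, by linarith⟩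
    have h4 : |F.im| < t / 2 := abs_lt.2 ⟨by linarith, by linarith⟩
    linarith
  refine (measure_mono hsub).trans ?_
  refine (measure_union_le _ _).trans ?_
  refine (add_le_add ((measure_union_le _ _).trans (add_le_add (measure_union_le _ _) le_rfl))
    le_rfl).trans ?_
  have e : ∀ x : ℝ≥0∞, 4 * x = x + x + x + x := fun x => by ring
  rw [e]
  exact add_le_add (add_le_add (add_le_add (h _ (by simp)) (h _ (by simp))) (h _ (by simp)))
    (h _ (by simp))

theorem norm_RCLike_map_le (x : 𝕜) : ‖RCLike.map 𝕜 ℂ x‖ ≤ ‖x‖ := by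
  rw [← sq_le_sq₀ (norm_nonneg _) (norm_nonneg _), ← RCLike.normSq_eq_def', ← RCLike.normSq_eq_def']
  simp [RCLike.map_apply, RCLike.normSq_apply]

/-- Tail estimate `exp (-c t ^ r)` for bounded subgaussian variables and `ℓ_q` coefficients,
`q` being the conjugate exponent of `r`. -/
theorem measure_le_norm_sum_le_of_bounded (hind : iIndepFun γ P) (hmeas : ∀ i, Measurable (γ i))
    (hS : ∀ i, S ∈ subgaussianConstants (γ i) P) (hS0 : 0 < S) {M : ℝ} (hM0 : 0 < M)
    (hM : ∀ i, ∀ᵐ ω ∂P, ‖γ i ω‖ ≤ M) {r q : ℝ} (hr : 2 < r) (hq : q = r.conjExponent)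
    (a : ι → ℂ) {A : ℝ} (hA : 0 < A)
    (haA : ∑ i, ‖a i‖ ^ q ≤ A ^ q) {t : ℝ} (ht : 0 < t) :
    P {ω | t ≤ ‖∑ i, RCLike.map 𝕜 ℂ (γ i ω) * a i‖}
      ≤ 4 * ENNReal.ofReal (Real.exp (-((32 * S ^ 2 * (2 * M) ^ (r - 2))⁻¹ * (t / A) ^ r))) := by
  have hr1 : r - 1 ≠ 0 := by linarith
  have hqe : q - 1 = 1 / (r - 1) := by
    rw [hq, Real.conjExponent]
    field_simp
    ring
  have hq1 : 1 < q := by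
    have : 0 < 1 / (r - 1) := by
      apply one_div_pos.2
      linarith
    linarith
  have hq2 : q < 2 := by
    have : 1 / (r - 1) < 1 := by
      rw [div_lt_one] <;> linarith
    linarith
  -- The threshold `u` between small and large coefficients is chosen so that the large ones have
  -- `ℓ_1` norm at most `A / B`, hence contribute at most `M A / B = t / 2`. The small ones then
  -- have square sum at most `A ^ 2 B ^ (r - 2)`, which turns the Gaussian exponent into a multiple
  -- of `(t / A) ^ r`.
  set B : ℝ := 2 * M / (t / A) with hB
  have hB0 : 0 < B := by positivity
  set u : ℝ := A * B ^ (r - 1) with hu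
  have hu0 : 0 < u := by positivity
  have e1 : u ^ (1 - q) * A ^ q = A * B⁻¹ := by
    rw [hu, Real.mul_rpow hA.le (by positivity), ← Real.rpow_mul hB0.le,
      show (r - 1) * (1 - q) = -1 by
        rw [show 1 - q = -(1 / (r - 1)) by linarith]
        field_simp,
      Real.rpow_neg_one, mul_right_comm, ← Real.rpow_add hA]
    simp
  have e2 : u ^ (2 - q) * A ^ q = A ^ 2 * B ^ (r - 2) := by
    rw [hu, Real.mul_rpow hA.le (by positivity), ← Real.rpow_mul hB0.le,
      show (r - 1) * (2 - q) = r - 2 by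
        rw [show 2 - q = 1 - (1 / (r - 1)) by linarith]
        field_simp
        ring,
      mul_right_comm, ← Real.rpow_add hA]
    norm_num
  set a₁ : ι → ℂ := fun i => if ‖a i‖ ≤ u then a i else 0 with ha₁
  set a₂ : ι → ℂ := fun i => if ‖a i‖ ≤ u then 0 else a i with ha₂
  have hsplit : ∀ i, a i = a₁ i + a₂ i := by
    intro i
    simp only [ha₁, ha₂]
    split_ifs <;> simp
  have hsq : ∑ i, ‖a₁ i‖ ^ 2 ≤ A ^ 2 * B ^ (r - 2) := by
    rw [← e2]
    refine le_trans ?_ (mul_le_mul_of_nonneg_left haA (by positivity))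
    rw [Finset.mul_sum]
    refine Finset.sum_le_sum fun i _ => ?_
    simp only [ha₁]
    split_ifs with h
    · have : ‖a i‖ ^ 2 = ‖a i‖ ^ (2 - q) * ‖a i‖ ^ q := by
        rw [← Real.rpow_add_of_nonneg (norm_nonneg _) (by linarith) (by linarith)]
        norm_num
      rw [this]
      gcongr
    · simp
      positivity
  have hl1 : ∑ i, ‖a₂ i‖ ≤ A * B⁻¹ := by
    rw [← e1]
    refine le_trans ?_ (mul_le_mul_of_nonneg_left haA (by positivity))
    rw [Finset.mul_sum]
    refine Finset.sum_le_sum fun i _ => ?_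
    simp only [ha₂]
    split_ifs with h
    · simp
      positivity
    · rw [not_le] at h
      have : ‖a i‖ = ‖a i‖ ^ (1 - q) * ‖a i‖ ^ q := by
        rw [← Real.rpow_add (hu0.trans h)]
        simp
      conv_lhs => rw [this]
      refine mul_le_mul_of_nonneg_right ?_ (by positivity)
      exact Real.rpow_le_rpow_of_nonpos hu0 h.le (by linarith)
  have hV : 0 < S ^ 2 * (A ^ 2 * B ^ (r - 2)) := by positivity
  have hmain := measure_le_norm_sum_le hind hmeas hS a₁ hV (by gcongr) (half_pos ht)
  have hle : P {ω | t ≤ ‖∑ i, RCLike.map 𝕜 ℂ (γ i ω) * a i‖} ≤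
      P {ω | t / 2 ≤ ‖∑ i, RCLike.map 𝕜 ℂ (γ i ω) * a₁ i‖} := by
    refine measure_mono_ae ?_
    filter_upwards [ae_all_iff.2 hM] with ω hω h
    change t ≤ _ at h
    change t / 2 ≤ _
    simp_rw [hsplit, mul_add, Finset.sum_add_distrib] at h
    have h2 : ‖∑ i, RCLike.map 𝕜 ℂ (γ i ω) * a₂ i‖ ≤ t / 2 := by
      calc ‖∑ i, RCLike.map 𝕜 ℂ (γ i ω) * a₂ i‖ ≤ ∑ i, ‖RCLike.map 𝕜 ℂ (γ i ω) * a₂ i‖ :=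
            norm_sum_le _ _
        _ ≤ ∑ i, M * ‖a₂ i‖ := by
            refine Finset.sum_le_sum fun i _ => ?_
            rw [norm_mul]
            exact mul_le_mul_of_nonneg_right ((norm_RCLike_map_le _).trans (hω i)) (norm_nonneg _)
        _ ≤ M * (A * B⁻¹) := by
            rw [← Finset.mul_sum]
            gcongr
        _ = t / 2 := by
            rw [hB]
            field_simp
    linarith [norm_add_le (∑ i, RCLike.map 𝕜 ℂ (γ i ω) * a₁ i)
      (∑ i, RCLike.map 𝕜 ℂ (γ i ω) * a₂ i)]
  refine hle.trans (hmain.trans_eq ?_)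
  congr 4
  have h3 : B ^ (r - 2) = (2 * M) ^ (r - 2) / (t / A) ^ (r - 2) := by
    rw [hB, Real.div_rpow (by positivity) (by positivity)]
  have h4 : (t / A) ^ r = (t / A) ^ (r - 2) * (t / A) ^ 2 := by
    rw [← Real.rpow_natCast, ← Real.rpow_add (by positivity)]
    norm_num
  rw [h3, h4]
  have : (t / A) ^ (r - 2) ≠ 0 := by positivity
  have : (2 * M) ^ (r - 2) ≠ 0 := by positivity
  generalize (t / A) ^ (r - 2) = X at *
  generalize (2 * M) ^ (r - 2) = Z at *
  field_simp
  ring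

end Tails

/-! ### From tails to Orlicz norms -/

/-- From a Weibull tail bound to an exponential moment. -/
theorem lintegral_exp_rpow_le_two {Ω : Type*} [MeasurableSpace Ω] {P : Measure Ω}
    [IsProbabilityMeasure P] {Y : Ω → ℝ} (hY : Measurable Y) (hY0 : ∀ ω, 0 ≤ Y ω)
    {r c A K ε : ℝ} (hr : 0 < r) (hA : 0 < A) (hK : 1 ≤ K) (hε : 0 < ε)
    (htail : ∀ t : ℝ, 0 < t →
      P {ω | t ≤ Y ω} ≤ ENNReal.ofReal K * ENNReal.ofReal (Real.exp (-(c * (t / A) ^ r))))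
    (hL : 3 * (1 + Real.log K) ≤ c * (ε / A) ^ r) :
    ∫⁻ ω, ENNReal.ofReal (Real.exp ((Y ω / ε) ^ r)) ∂P ≤ 2 := by
  set L : ℝ := 3 * (1 + Real.log K) with hLdef
  have hlogK : 0 ≤ Real.log K := Real.log_nonneg hK
  have hL3 : 3 ≤ L := by linarith
  have hmeas : Measurable fun ω => Real.exp ((Y ω / ε) ^ r) := by fun_prop
  rw [lintegral_eq_lintegral_meas_lt P (ae_of_all _ fun ω => (Real.exp_pos _).le)
    hmeas.aemeasurable]
  have hpt : ∀ t : ℝ, 1 < t → P {ω | t < Real.exp ((Y ω / ε) ^ r)} ≤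
      ENNReal.ofReal (K * t ^ (-L)) := by
    intro t ht
    have hlog : 0 < Real.log t := Real.log_pos ht
    have h1 : {ω | t < Real.exp ((Y ω / ε) ^ r)} ⊆ {ω | ε * Real.log t ^ (1 / r) ≤ Y ω} := by
      intro ω hω
      simp only [Set.mem_ofPred_eq] at hω ⊢
      have h2 : Real.log t ≤ (Y ω / ε) ^ r := ((Real.log_lt_iff_lt_exp (by linarith)).2 hω).le
      have hYe : 0 ≤ Y ω / ε := div_nonneg (hY0 ω) hε.le
      have h3 := Real.rpow_le_rpow hlog.le h2 (by positivity : 0 ≤ 1 / r)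
      rw [← Real.rpow_mul hYe, mul_one_div_cancel hr.ne', Real.rpow_one, le_div_iff₀ hε] at h3
      linarith
    refine (measure_mono h1).trans ((htail _ (by positivity)).trans ?_)
    rw [← ENNReal.ofReal_mul (by linarith)]
    refine ENNReal.ofReal_le_ofReal ?_
    have h4 : (ε * Real.log t ^ (1 / r) / A) ^ r = (ε / A) ^ r * Real.log t := by
      rw [mul_div_right_comm, Real.mul_rpow (by positivity) (by positivity),
        ← Real.rpow_mul hlog.le, one_div_mul_cancel hr.ne', Real.rpow_one]
    rw [h4, Real.rpow_def_of_pos (by linarith) (-L)]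
    refine mul_le_mul_of_nonneg_left (Real.exp_le_exp.2 ?_) (by linarith)
    nlinarith
  -- The layer-cake integral is cut at `3 / 2`: below, probabilities are at most `1`; above, the
  -- power tail contributes at most `1 / 2`, because `log (3 / 2) ≥ 1 / 3` gives `K (3 / 2) ^ (1 -
  -- L) ≤ 1`, and `L - 1 ≥ 2`.
  have hT : (0 : ℝ) < 3 / 2 := by norm_num
  rw [← Set.Ioc_union_Ioi_eq_Ioi hT.le, lintegral_union measurableSet_Ioi
    (Set.Ioc_disjoint_Ioi le_rfl)]
  have hI1 : ∫⁻ t in Set.Ioc (0 : ℝ) (3 / 2), P {ω | t < Real.exp ((Y ω / ε) ^ r)} ≤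
      ENNReal.ofReal (3 / 2) := by
    calc _ ≤ ∫⁻ t in Set.Ioc (0 : ℝ) (3 / 2), (1 : ℝ≥0∞) := lintegral_mono fun t => prob_le_one
      _ = _ := by simp
  have hI2 : ∫⁻ t in Set.Ioi (3 / 2 : ℝ), P {ω | t < Real.exp ((Y ω / ε) ^ r)} ≤
      ENNReal.ofReal (1 / 2) := by
    calc _ ≤ ∫⁻ t in Set.Ioi (3 / 2 : ℝ), ENNReal.ofReal (K * t ^ (-L)) := by
          refine setLIntegral_mono' measurableSet_Ioi fun t ht => hpt t ?_
          have : (3 / 2 : ℝ) < t := ht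
          linarith
      _ = ENNReal.ofReal (∫ t in Set.Ioi (3 / 2 : ℝ), K * t ^ (-L)) := by
          rw [ofReal_integral_eq_lintegral_ofReal]
          · exact (integrableOn_Ioi_rpow_of_lt (by linarith) hT).const_mul K
          · refine (ae_restrict_iff' measurableSet_Ioi).2 (ae_of_all _ fun t ht => ?_)
            have : (3 / 2 : ℝ) < t := ht
            have : 0 < t := by linarith
            simp only [Pi.zero_apply]
            positivity
      _ ≤ _ := by
          refine ENNReal.ofReal_le_ofReal ?_
          rw [integral_const_mul, integral_Ioi_rpow_of_lt (by linarith) hT]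
          have h5 : K * (3 / 2 : ℝ) ^ (-L + 1) ≤ 1 := by
            have hl : 1 / 3 ≤ Real.log (3 / 2) := by
              have := Real.one_sub_inv_le_log_of_pos hT
              norm_num at this ⊢
              linarith
            rw [Real.rpow_def_of_pos hT]
            calc K * Real.exp (Real.log (3 / 2) * (-L + 1))
                = Real.exp (Real.log K + Real.log (3 / 2) * (-L + 1)) := by
                  rw [Real.exp_add, Real.exp_log (by linarith)]
              _ ≤ Real.exp 0 := Real.exp_le_exp.2 (by nlinarith)
              _ = 1 := Real.exp_zero
          have h6 : -(3 / 2 : ℝ) ^ (-L + 1) / (-L + 1) = (3 / 2 : ℝ) ^ (-L + 1) / (L - 1) := by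
            rw [← neg_div_neg_eq]
            congr 1 <;> ring
          rw [h6, ← mul_div_assoc]
          rw [div_le_iff₀ (by linarith)]
          linarith
  refine (add_le_add hI1 hI2).trans_eq ?_
  rw [← ENNReal.ofReal_add (by norm_num) (by norm_num)]
  norm_num

theorem expOrliczNorm_le_of_lintegral_exp_le {Ω : Type*} [MeasurableSpace Ω] {P : Measure Ω}
    [IsProbabilityMeasure P] {r ε : ℝ} (hε : 0 < ε) {f : Ω → ℝ}
    (h : ∫⁻ ω, ENNReal.ofReal (Real.exp ((|f ω| / ε) ^ r)) ∂P ≤ 2) :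
    expOrliczNorm r f P ≤ ENNReal.ofReal ε := by
  refine iInf₂_le ε ⟨hε, ?_⟩
  simp_rw [expOrlicz, ENNReal.ofReal_sub _ zero_le_one, ENNReal.ofReal_one]
  have h1 : ∀ ω, 1 ≤ ENNReal.ofReal (Real.exp ((|f ω| / ε) ^ r)) := by
    intro ω
    rw [← ENNReal.ofReal_one]
    refine ENNReal.ofReal_le_ofReal (Real.one_le_exp ?_)
    positivity
  rw [lintegral_sub measurable_const (by simp) (ae_of_all _ h1)]
  simp only [lintegral_const, measure_univ, mul_one]
  rw [tsub_le_iff_right, one_add_one_eq_two]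
  exact h

/-! ### Random polynomials on the unit ball of a norm on `ℂⁿ` -/

/-- The space `ℂⁿ`, to be normed by `N`. -/
def SeminormSpace {n : ℕ} (_N : Seminorm ℂ (Fin n → ℂ)) : Type := Fin n → ℂ

noncomputable instance {n : ℕ} (N : Seminorm ℂ (Fin n → ℂ)) : AddCommGroup (SeminormSpace N) :=
  inferInstanceAs (AddCommGroup (Fin n → ℂ))

noncomputable instance {n : ℕ} (N : Seminorm ℂ (Fin n → ℂ)) : Module ℂ (SeminormSpace N) :=
  inferInstanceAs (Module ℂ (Fin n → ℂ))

noncomputable instance {n : ℕ} (N : Seminorm ℂ (Fin n → ℂ)) : FiniteDimensional ℂ (SeminormSpace N) :=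
  inferInstanceAs (FiniteDimensional ℂ (Fin n → ℂ))

noncomputable instance {n : ℕ} (N : Seminorm ℂ (Fin n → ℂ)) : Norm (SeminormSpace N) := ⟨fun z => N z⟩

theorem SeminormSpace.core {n : ℕ} {N : Seminorm ℂ (Fin n → ℂ)} (hN : ∀ z, N z = 0 → z = 0) :
    NormedSpace.Core ℂ (SeminormSpace N) where
  norm_nonneg z := apply_nonneg N z
  norm_smul a z := map_smul_eq_mul N a z
  norm_triangle z w := map_add_le_add N z w
  norm_eq_zero_iff z := ⟨hN z, fun h => h ▸ map_zero N⟩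

section Norm

variable {n : ℕ} {N : Seminorm ℂ (Fin n → ℂ)}

theorem exists_norming_finset_seminorm (hN : ∀ z, N z = 0 → z = 0) {m : ℕ} (hm : 1 ≤ m) :
    ∃ s : Finset (Fin n → ℂ), s.Nonempty ∧ (∀ c ∈ s, N c ≤ 1) ∧
      (s.card : ℝ) ≤ (25 * m : ℝ) ^ (2 * n) ∧
      ∀ f : (Fin n → ℂ) → ℂ, IsLinewisePolynomial m f →
        (∃ b : ℝ, ∀ x, N x ≤ 1 → ‖f x‖ ≤ b) →
        ∀ b : ℝ, (∀ c ∈ s, ‖f c‖ ≤ b) → ∀ x, N x ≤ 1 → ‖f x‖ ≤ 2 * b := by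
  let : NormedAddCommGroup (SeminormSpace N) :=
    NormedAddCommGroup.ofCore (SeminormSpace.core hN)
  let : NormedSpace ℂ (SeminormSpace N) := NormedSpace.ofCore (SeminormSpace.core hN)
  obtain ⟨s, hs, h1, h2, h3⟩ := exists_norming_finset (SeminormSpace N) hm
  have hfin : Module.finrank ℂ (SeminormSpace N) = n :=
    (Module.finrank_fin_fun ℂ : Module.finrank ℂ (Fin n → ℂ) = n)
  rw [hfin] at h2
  refine ⟨s, hs, h1, h2, fun f hf hb b hfb x hx => h3 f hf ?_ b hfb x hx⟩
  obtain ⟨b, hb⟩ := hb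
  refine ⟨b, ?_⟩
  rintro _ ⟨y, hy, rfl⟩
  exact hb y (mem_closedBall_zero_iff.1 hy)

/-- Linear maps on a finite-dimensional space are continuous. The bound keeps the real suprema over
the ball from taking the default value `0` of an unbounded `iSup`. -/
theorem exists_coord_bound (hN : ∀ z, N z = 0 → z = 0) :
    ∃ R : ℝ, 0 ≤ R ∧ ∀ z, N z ≤ 1 → ∀ i, ‖z i‖ ≤ R := by
  let : NormedAddCommGroup (SeminormSpace N) :=
    NormedAddCommGroup.ofCore (SeminormSpace.core hN)
  let : NormedSpace ℂ (SeminormSpace N) := NormedSpace.ofCore (SeminormSpace.core hN)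
  let φ : SeminormSpace N →ₗ[ℂ] (Fin n → ℂ) := (LinearMap.id : (Fin n → ℂ) →ₗ[ℂ] (Fin n → ℂ))
  let T := LinearMap.toContinuousLinearMap φ
  refine ⟨‖T‖, norm_nonneg _, fun z hz i => ?_⟩
  have h1 : ‖T (z : SeminormSpace N)‖ ≤ ‖T‖ * N z := T.le_opNorm (z : SeminormSpace N)
  have h2 : ‖z i‖ ≤ ‖z‖ := norm_le_pi_norm z i
  have h3 : ‖T‖ * N z ≤ ‖T‖ := mul_le_of_le_one_right (norm_nonneg _) hz
  exact h2.trans (h1.trans h3)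

theorem mem_multiIndicesLE {m : ℕ} {α : Fin n → ℕ} : α ∈ multiIndicesLE n m ↔ ∑ i, α i ≤ m := by
  simp [multiIndicesLE, multiIndicesEq]

variable {𝕜 : Type*} [RCLike 𝕜] {m : ℕ}

theorem polyValue_isLinewisePolynomial (g : multiIndicesLE n m → 𝕜) (c : (Fin n → ℕ) → ℂ)
    {d : ℕ} (hmd : m ≤ d) : IsLinewisePolynomial d (polyValue g c) := by
  intro x y
  refine ⟨∑ α : multiIndicesLE n m, Polynomial.C (RCLike.map 𝕜 ℂ (g α) * c α) *
    ∏ i, (Polynomial.C (x i) + Polynomial.C (y i) * Polynomial.X) ^ (α : Fin n → ℕ) i, ?_, ?_⟩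
  · refine Polynomial.natDegree_sum_le_of_forall_le _ _ fun α _ => ?_
    refine (Polynomial.natDegree_C_mul_le _ _).trans ((Polynomial.natDegree_prod_le _ _).trans ?_)
    refine le_trans (Finset.sum_le_sum fun i _ => ?_) ((mem_multiIndicesLE.1 α.2).trans hmd)
    refine Polynomial.natDegree_pow_le.trans (mul_le_of_le_one_right (Nat.zero_le _) ?_)
    rw [add_comm]
    exact Polynomial.natDegree_linear_le
  · intro t
    simp [polyValue, Polynomial.eval_finsetSum, Polynomial.eval_prod, mul_comm t]

theorem exists_bound_polyValue (hN : ∀ z, N z = 0 → z = 0) (g : multiIndicesLE n m → 𝕜)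
    (c : (Fin n → ℕ) → ℂ) : ∃ b : ℝ, ∀ z, N z ≤ 1 → ‖polyValue g c z‖ ≤ b := by
  obtain ⟨R, hR0, hR⟩ := exists_coord_bound hN
  refine ⟨∑ α : multiIndicesLE n m, ‖RCLike.map 𝕜 ℂ (g α) * c α‖ *
    ∏ i, R ^ (α : Fin n → ℕ) i, fun z hz => ?_⟩
  refine (norm_sum_le _ _).trans (Finset.sum_le_sum fun α _ => ?_)
  rw [norm_mul, norm_prod]
  refine mul_le_mul_of_nonneg_left ?_ (norm_nonneg _)
  refine Finset.prod_le_prod (fun i _ => norm_nonneg _) fun i _ => ?_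
  rw [norm_pow]
  exact pow_le_pow_left₀ (norm_nonneg _) (hR z hz i) _

theorem mem_seminorm_closedBall {z : Fin n → ℂ} : z ∈ N.closedBall 0 1 ↔ N z ≤ 1 := by
  simp [Seminorm.mem_closedBall]

theorem coeffSum_nonneg (q : ℝ) (c : (Fin n → ℕ) → ℂ) : 0 ≤ coeffSum m q N c := by
  refine Finset.sum_nonneg fun k _ => mul_nonneg ?_ ?_
  · exact Real.iSup_nonneg fun α => by positivity
  · exact Real.iSup_nonneg fun z => by positivity

/-- In degree `k` the weight `α! / k!` is the inverse of the multinomial coefficient, so the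
multinomial theorem sums the monomials to `(∑ |z_i| ^ q) ^ k`. -/
theorem sum_monomial_rpow_le_coeffSum (hN : ∀ z, N z = 0 → z = 0) {q : ℝ} (hq : 0 < q)
    (c : (Fin n → ℕ) → ℂ) {z : Fin n → ℂ} (hz : N z ≤ 1) :
    ∑ α : multiIndicesLE n m, ‖c α * ∏ i, z i ^ (α : Fin n → ℕ) i‖ ^ q ≤ coeffSum m q N c := by
  rw [Finset.sum_coe_sort (multiIndicesLE n m) (fun α => ‖c α * ∏ i, z i ^ α i‖ ^ q),
    multiIndicesLE, Finset.sum_biUnion]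
  · refine Finset.sum_le_sum fun k _ => ?_
    set Sk : ℝ := ⨆ α : multiIndicesEq n k,
      ‖c α‖ ^ q * (∏ i, ((α : Fin n → ℕ) i).factorial : ℕ) / (k.factorial : ℝ) with hSk
    have hSk0 : 0 ≤ Sk := Real.iSup_nonneg fun α => by positivity
    have hk : (0 : ℝ) < k.factorial := by exact_mod_cast k.factorial_pos
    have h1 : ∑ α ∈ multiIndicesEq n k, ‖c α * ∏ i, z i ^ α i‖ ^ q ≤
        Sk * (∑ i, ‖z i‖ ^ q) ^ k := by
      rw [Finset.sum_pow_eq_sum_piAntidiag, Finset.mul_sum]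
      refine Finset.sum_le_sum fun α hα => ?_
      have hαk : ∑ i, α i = k := (Finset.mem_piAntidiag.1 hα).1
      have h2 : ‖c α * ∏ i, z i ^ α i‖ ^ q = ‖c α‖ ^ q * ∏ i, (‖z i‖ ^ q) ^ α i := by
        rw [norm_mul, Real.mul_rpow (norm_nonneg _) (norm_nonneg _), norm_prod,
          ← Real.finsetProd_rpow _ _ fun i _ => norm_nonneg _]
        congr 1
        refine Finset.prod_congr rfl fun i _ => ?_
        rw [norm_pow, ← Real.rpow_natCast, ← Real.rpow_natCast, ← Real.rpow_mul (norm_nonneg _),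
          ← Real.rpow_mul (norm_nonneg _), mul_comm]
      have h3 : ‖c α‖ ^ q * (∏ i, (α i).factorial : ℕ) / (k.factorial : ℝ) ≤ Sk :=
        le_ciSup (f := fun α : multiIndicesEq n k =>
          ‖c α‖ ^ q * (∏ i, ((α : Fin n → ℕ) i).factorial : ℕ) / (k.factorial : ℝ))
          (Set.finite_range _).bddAbove ⟨α, hα⟩
      have h4 : ((∏ i, (α i).factorial : ℕ) : ℝ) * (Nat.multinomial Finset.univ α : ℝ)
          = k.factorial := by
        rw [← hαk]
        exact_mod_cast Nat.multinomial_spec Finset.univ α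
      have h5 : ‖c α‖ ^ q = ‖c α‖ ^ q * (∏ i, (α i).factorial : ℕ) / (k.factorial : ℝ) *
          (Nat.multinomial Finset.univ α : ℝ) := by
        rw [div_mul_eq_mul_div, mul_assoc, h4, mul_div_assoc, div_self hk.ne', mul_one]
      rw [h2, h5, ← mul_assoc]
      gcongr
    refine h1.trans (mul_le_mul_of_nonneg_left ?_ hSk0)
    obtain ⟨R, hR0, hR⟩ := exists_coord_bound hN
    refine le_ciSup (f := fun z : N.closedBall 0 1 => (∑ i, ‖(z : Fin n → ℂ) i‖ ^ q) ^ k)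
      ⟨(∑ _i : Fin n, R ^ q) ^ k, ?_⟩ ⟨z, mem_seminorm_closedBall.2 hz⟩
    rintro _ ⟨w, rfl⟩
    have hw := hR w (mem_seminorm_closedBall.1 w.2)
    simp only
    gcongr with i
    exact hw i
  · intro k _ l _ hkl
    refine Finset.disjoint_left.2 fun α hα hα' => hkl ?_
    exact (Finset.mem_piAntidiag.1 hα).1.symm.trans (Finset.mem_piAntidiag.1 hα').1

/-- A Weibull tail estimate for linear combinations implies the Orlicz norm estimate for the
supremum of a random polynomial. -/
theorem expOrliczNorm_polySup_le {Ω : Type*} [MeasurableSpace Ω] {P : Measure Ω}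
    [IsProbabilityMeasure P] (hN : ∀ z, N z = 0 → z = 0) (hn : 1 ≤ n)
    {γ : multiIndicesLE n m → Ω → 𝕜} (hγ : ∀ α, Measurable (γ α)) (c : (Fin n → ℕ) → ℂ)
    {r q κ : ℝ} (hr : 0 < r) (hq : 0 < q) (hκ : 0 < κ)
    (htail : ∀ a : multiIndicesLE n m → ℂ, ∀ A : ℝ, 0 < A → ∑ α, ‖a α‖ ^ q ≤ A ^ q →
      ∀ t : ℝ, 0 < t → P {ω | t ≤ ‖∑ α, RCLike.map 𝕜 ℂ (γ α ω) * a α‖}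
        ≤ 4 * ENNReal.ofReal (Real.exp (-(κ * (t / A) ^ r)))) :
    expOrliczNorm r (fun ω => polySup N (fun α => γ α ω) c) P
      ≤ ENNReal.ofReal (2 * (156 / κ) ^ (1 / r) * (n * (1 + Real.log m)) ^ (1 / r)
          * coeffSum m q N c ^ (1 / q)) := by
  -- The norming set needs degree at least `1`; the logarithm is unchanged because `Real.log 0 = 0`.
  set d := max m 1 with hd
  have hd1 : 1 ≤ d := le_max_right _ _
  have hlogd : Real.log d = Real.log m := by
    rcases Nat.eq_zero_or_pos m with h | h
    · simp [hd, h]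
    · rw [hd, max_eq_left h]
  have hd1' : (1 : ℝ) ≤ d := by exact_mod_cast hd1
  have hlog0 : 0 ≤ Real.log m := hlogd ▸ Real.log_nonneg hd1'
  have hn' : (1 : ℝ) ≤ n := by exact_mod_cast hn
  obtain ⟨s, hs, hs1, hcard, hnorming⟩ := exists_norming_finset_seminorm hN hd1
  have hpoly : ∀ ω z, polyValue (fun α => γ α ω) c z =
      ∑ α, RCLike.map 𝕜 ℂ (γ α ω) * (c α * ∏ i, z i ^ (α : Fin n → ℕ) i) := by
    intro ω z
    simp only [polyValue, mul_assoc]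
  -- A finite maximum is measurable. Only the domination of `polySup` by `2 Y` is used, so
  -- measurability of `polySup` itself is not needed.
  set Y : Ω → ℝ := fun ω => s.sup' hs fun z => ‖polyValue (fun α => γ α ω) c z‖ with hYdef
  have hYm : Measurable Y := by
    have h := Finset.measurable_sup' hs
      (f := fun z ω => ‖polyValue (fun α => γ α ω) c z‖) fun z _ => by
        simp_rw [hpoly]
        exact (measurable_sum_map_mul hγ _).norm
    convert h using 1
    ext ω
    simp [hYdef, Finset.sup'_apply]
  have hYle : ∀ ω, ∀ z ∈ s, ‖polyValue (fun α => γ α ω) c z‖ ≤ Y ω := fun ω z hz =>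
    Finset.le_sup' (fun z => ‖polyValue (fun α => γ α ω) c z‖) hz
  have hY0 : ∀ ω, 0 ≤ Y ω := fun ω =>
    (norm_nonneg _).trans (hYle ω _ hs.choose_spec)
  have hsup : ∀ ω, |polySup N (fun α => γ α ω) c| ≤ 2 * Y ω := by
    intro ω
    rw [polySup, abs_of_nonneg (Real.iSup_nonneg fun _ => norm_nonneg _)]
    refine Real.iSup_le (fun z => ?_) (by linarith [hY0 ω])
    exact hnorming _ (polyValue_isLinewisePolynomial _ c (le_max_left _ _))
      (exists_bound_polyValue hN _ c) _ (hYle ω) z (mem_seminorm_closedBall.1 z.2)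
  set K : ℝ := 4 * (25 * d : ℝ) ^ (2 * n) with hK
  have hK1 : 1 ≤ K := by
    have : 1 ≤ (25 * d : ℝ) ^ (2 * n) := one_le_pow₀ (by linarith)
    linarith
  -- With `log 4 ≤ 3` and `log 25 ≤ 24`, the left side is at most `12 + 144 n + 6 n log m`, and `156
  -- = 12 + 144`.
  have hlogK : 3 * (1 + Real.log K) ≤ 156 * (n * (1 + Real.log m)) := by
    rw [hK, Real.log_mul (by norm_num) (by positivity), Real.log_pow,
      Real.log_mul (by norm_num) (by positivity), hlogd]
    have h4 := Real.log_le_sub_one_of_pos (show (0 : ℝ) < 4 by norm_num)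
    have h25 := Real.log_le_sub_one_of_pos (show (0 : ℝ) < 25 by norm_num)
    push_cast
    have : (0 : ℝ) ≤ n * Real.log m := by positivity
    nlinarith
  set A₀ := coeffSum m q N c ^ (1 / q) with hA₀
  have hA₀0 : 0 ≤ A₀ := Real.rpow_nonneg (coeffSum_nonneg q c) _
  have hX : 0 < (n : ℝ) * (1 + Real.log m) := by positivity
  set D : ℝ := 2 * (156 / κ) ^ (1 / r) * (n * (1 + Real.log m)) ^ (1 / r) with hD
  have hD0 : 0 < D := by positivity
  -- `A₀` may vanish while the tail estimate divides by `A`; hence the strict inequality, followed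
  -- by the limit `A ↓ A₀`.
  have key : ∀ A : ℝ, A₀ < A →
      expOrliczNorm r (fun ω => polySup N (fun α => γ α ω) c) P ≤ ENNReal.ofReal (D * A) := by
    intro A hAA
    have hA : 0 < A := hA₀0.trans_lt hAA
    have hAq : coeffSum m q N c ≤ A ^ q := by
      have := Real.rpow_le_rpow hA₀0 hAA.le hq.le
      rwa [hA₀, ← Real.rpow_mul (coeffSum_nonneg q c), one_div_mul_cancel hq.ne',
        Real.rpow_one] at this
    have hε : 0 < D / 2 * A := by positivity
    refine expOrliczNorm_le_of_lintegral_exp_le (by positivity) ?_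
    refine le_trans (lintegral_mono fun ω => ENNReal.ofReal_le_ofReal ?_)
      (lintegral_exp_rpow_le_two (P := P) hYm hY0 hr hA hK1 hε (c := κ) ?_ ?_)
    · have h1 : |polySup N (fun α => γ α ω) c| / (D * A) ≤ Y ω / (D / 2 * A) := by
        rw [div_le_div_iff₀ (by positivity) hε]
        have := mul_le_mul_of_nonneg_right (hsup ω) hε.le
        linarith
      gcongr
    · intro t ht
      have hsub : {ω | t ≤ Y ω} ⊆ ⋃ z ∈ s, {ω | t ≤ ‖polyValue (fun α => γ α ω) c z‖} := by
        intro ω hω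
        obtain ⟨z, hz, h⟩ := (Finset.le_sup'_iff hs).1 (show t ≤ Y ω from hω)
        exact Set.mem_biUnion hz h
      refine (measure_mono hsub).trans ((measure_biUnion_finset_le _ _).trans ?_)
      refine (Finset.sum_le_card_nsmul _ _
        (4 * ENNReal.ofReal (Real.exp (-(κ * (t / A) ^ r)))) fun z hz => ?_).trans ?_
      · simp_rw [hpoly]
        exact htail _ A hA ((sum_monomial_rpow_le_coeffSum hN hq c (hs1 z hz)).trans hAq) t ht
      · rw [nsmul_eq_mul, ← mul_assoc]
        gcongr
        rw [hK, mul_comm, ENNReal.ofReal_mul (by norm_num)]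
        gcongr
        · simp
        · rw [← ENNReal.ofReal_natCast]
          exact ENNReal.ofReal_le_ofReal hcard
    · refine hlogK.trans_eq ?_
      rw [mul_div_assoc, div_self hA.ne', mul_one, hD, mul_assoc, mul_div_cancel_left₀ _ two_ne_zero,
        Real.mul_rpow (by positivity) (by positivity), ← Real.rpow_mul (by positivity),
        ← Real.rpow_mul hX.le, one_div_mul_cancel hr.ne', Real.rpow_one, Real.rpow_one]
      field_simp
  have hlim : Filter.Tendsto (fun A => ENNReal.ofReal (D * A)) (nhdsWithin A₀ (Set.Ioi A₀))
      (nhds (ENNReal.ofReal (D * A₀))) := by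
    refine ((ENNReal.continuous_ofReal.comp (continuous_const_mul D)).tendsto A₀).mono_left
      nhdsWithin_le_nhds
  refine ge_of_tendsto hlim ?_
  filter_upwards [self_mem_nhdsWithin] with A hA
  exact key A hA

end Norm

/-! ### The main theorem -/

theorem mainTheorem9 :
    -- the case `r = 2`, with a constant depending only on `s`
    (∀ s : ℝ, ∃ C : ℝ, 0 < C ∧
      ∀ (𝕜 : Type*) [RCLike 𝕜] (Ω : Type*) [MeasurableSpace Ω] (P : Measure Ω)
        [IsProbabilityMeasure P] (n m : ℕ) (N : Seminorm ℂ (Fin n → ℂ))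
        (γ : multiIndicesLE n m → Ω → 𝕜) (c : (Fin n → ℕ) → ℂ),
        1 ≤ n →
        (∀ z, N z = 0 → z = 0) →
        iIndepFun γ P →
        (∀ α, IsSubgaussian (γ α) P) →
        (∀ α, sg (γ α) P ≤ s) →
        expOrliczNorm 2 (fun ω => polySup N (fun α => γ α ω) c) P
          ≤ ENNReal.ofReal (C * (n * (1 + Real.log m)) ^ (1 / 2 : ℝ)
              * coeffSum m 2 N c ^ (1 / 2 : ℝ))) ∧
    -- the case `2 < r < ∞`, with a constant depending only on `r`, `s` and `M`
    (∀ r : ℝ, 2 < r → ∀ s M : ℝ, ∃ C : ℝ, 0 < C ∧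
      ∀ (𝕜 : Type*) [RCLike 𝕜] (Ω : Type*) [MeasurableSpace Ω] (P : Measure Ω)
        [IsProbabilityMeasure P] (n m : ℕ) (N : Seminorm ℂ (Fin n → ℂ))
        (γ : multiIndicesLE n m → Ω → 𝕜) (c : (Fin n → ℕ) → ℂ),
        1 ≤ n →
        (∀ z, N z = 0 → z = 0) →
        iIndepFun γ P →
        (∀ α, IsSubgaussian (γ α) P) →
        (∀ α, sg (γ α) P ≤ s) →
        (∀ α, eLpNorm (γ α) ⊤ P ≤ ENNReal.ofReal M) →
        expOrliczNorm r (fun ω => polySup N (fun α => γ α ω) c) P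
          ≤ ENNReal.ofReal (C * (n * (1 + Real.log m)) ^ (1 / r)
              * coeffSum m r.conjExponent N c ^ (1 / r.conjExponent))) := by
  -- `|s| + 1` is positive and strictly above `sg`, so it is an admissible subgaussian constant
  -- whether or not the infimum is attained.
  have hS0 : ∀ s : ℝ, 0 < |s| + 1 := fun s => by positivity
  refine ⟨fun s => ?_, fun r hr s M => ?_⟩
  · have hκ : 0 < (8 * (|s| + 1) ^ 2)⁻¹ := by positivity
    refine ⟨2 * (156 / (8 * (|s| + 1) ^ 2)⁻¹) ^ (1 / 2 : ℝ), by positivity, ?_⟩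
    intro 𝕜 _ Ω _ P _ n m N γ c hn hN hind hsub hsg
    have hS : ∀ α, |s| + 1 ∈ subgaussianConstants (γ α) P := fun α =>
      mem_subgaussianConstants_of_sg_lt (hsub α) (by linarith [hsg α, le_abs_self s])
    refine expOrliczNorm_polySup_le hN hn (fun α => (hsub α).1) c two_pos two_pos hκ ?_
    intro a A hA haA t ht
    simp only [Real.rpow_two] at haA
    have hV : 0 < (|s| + 1) ^ 2 * A ^ 2 := by positivity
    refine (measure_le_norm_sum_le hind (fun α => (hsub α).1) hS a hV (by gcongr) ht).trans_eq ?_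
    congr 3
    rw [Real.rpow_two]
    field_simp
  · have hκ : 0 < (32 * (|s| + 1) ^ 2 * (2 * (|M| + 1)) ^ (r - 2))⁻¹ := by positivity
    refine ⟨2 * (156 / (32 * (|s| + 1) ^ 2 * (2 * (|M| + 1)) ^ (r - 2))⁻¹) ^ (1 / r),
      by positivity, ?_⟩
    intro 𝕜 _ Ω _ P _ n m N γ c hn hN hind hsub hsg hM
    have hS : ∀ α, |s| + 1 ∈ subgaussianConstants (γ α) P := fun α =>
      mem_subgaussianConstants_of_sg_lt (hsub α) (by linarith [hsg α, le_abs_self s])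
    have hbd : ∀ α, ∀ᵐ ω ∂P, ‖γ α ω‖ ≤ |M| + 1 := by
      intro α
      have h1 := hM α
      rw [eLpNorm_exponent_top] at h1
      filter_upwards [enorm_ae_le_eLpNormEssSup (γ α) P] with ω hω
      have h2 := hω.trans (h1.trans (ENNReal.ofReal_le_ofReal
        (show M ≤ |M| + 1 by linarith [le_abs_self M])))
      rw [← ofReal_norm] at h2
      exact (ENNReal.ofReal_le_ofReal_iff (by positivity)).1 h2
    have hq : 0 < r.conjExponent := div_pos (by linarith) (by linarith)
    refine expOrliczNorm_polySup_le hN hn (fun α => (hsub α).1) c (by linarith) hq hκ ?_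
    intro a A hA haA t ht
    exact measure_le_norm_sum_le_of_bounded hind (fun α => (hsub α).1) hS (hS0 s) (hS0 M) hbd hr rfl
      a hA haA ht
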